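/- Let $d\in\mathbb N$, let $B_d$ be the open unit ball of $\mathbb C^d$, and let $\mathcal H^2_d$ be the Drury--Arveson space, i.e. the reproducing kernel Hilbert space on $B_d$ with kernel $k(x,y)=\frac1{1-\langle x,y\rangle}$, and put $k_x=k(\cdot,x)$. A variety in $B_d$ is the common zero set $V=\{x\in B_d: f(x)=0\ \text{for all } f\in F\}$ of a non-empty set $F\subseteq\mathcal H^2_d$. For a variety $V$ let $H_V=\overline{\operatorname{span}}\{k_x:x\in V\}$, regarded (by restriction) as a Hilbert space of functions on $V$, and let $\mathcal M_V=\{f:V\to\mathbb C: fH_V\subseteq H_V\}$ be its multiplier algebra, with multiplication operators $M_f$ on $H_V$; $M_n(\mathcal M_V)$ carries the operator norm on $\bigoplus_{i=1}^n H_V$. A map $F=(f_1,\dots,f_d):V\to\mathbb C^d$ is a vector valued multiplier on $V$ if all $f_i\in\mathcal M_V$, and then $\|F\|_{Mult(V)}$ is the norm of the row operator $(M_{f_1},\dots,M_{f_d}):\bigoplus_{i=1}^d H_V\to H_V$. For varieties $V,W$ in $B_d$, a map $G:W\to V$ is a multiplier biholomorphism of $W$ onto $V$ if it is a vector valued multiplier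 on $W$ and has an inverse $V\to W$ that is a vector valued multiplier on $V$. For a linear map $\varphi:\mathcal M_V\to\mathcal M_W$ put $\|\varphi\|_{cb}=\sup_n\|\varphi^{(n)}\|$, where $\varphi^{(n)}:M_n(\mathcal M_V)\to M_n(\mathcal M_W)$ applies $\varphi$ to each entry. A multiplier algebra isomorphism is an algebra isomorphism $\varphi:\mathcal M_V\to\mathcal M_W$ with $\|\varphi\|_{cb}<\infty$ and $\|\varphi^{-1}\|_{cb}<\infty$ that has the form $\varphi(f)=f\circ G$ for some bijection $G:W\to V$. **Theorem.** Let $V$ and $W$ be varieties in $B_d$, assume that $V$ contains at least two points, and let $\varphi:\mathcal M_V\to\mathcal M_W$ be a multiplier algebra isomorphism given by $\varphi(f)=f\circ G$ for all $f\in\mathcal M_V$, where $G:W\to V$ is a multiplier biholomorphism of $W$ onto $V$. Then $$\frac1{\|\varphi^{-1}\|_{cb}}\le\|G\|_{Mult(W)}\le\|\varphi\|_{cb}.$$ -/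

import Mathlib

noncomputable section

open scoped ENNReal InnerProductSpace ComplexConjugate

namespace DruryArveson

/-! ### The Drury-Arveson space -/

/-- The open unit ball of `ℂ^d`, as a type. -/
abbrev Ball (d : ℕ) : Type := Metric.ball (0 : EuclideanSpace ℂ (Fin d)) 1

/-- The scalar kernel `k(x, y) = 1 / (1 - ⟨x, y⟩)`, where `⟨x, y⟩ = ∑ xᵢ conj yᵢ` is linear in `x`
(the inner product of Mathlib is linear in its second argument). -/
def kernelFun (d : ℕ) (x y : Ball d) : ℂ :=
  1 / (1 - ⟪(y : EuclideanSpace ℂ (Fin d)), (x : EuclideanSpace ℂ (Fin d))⟫_ℂ)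

/-- The same kernel, with values regarded as operators on `ℂ`. -/
def kernelMatrix (d : ℕ) : Matrix (Ball d) (Ball d) (ℂ →L[ℂ] ℂ) :=
  Matrix.of fun x y => kernelFun d x y • ContinuousLinearMap.id ℂ ℂ

theorem norm_inner_lt_one {d : ℕ} (x y : Ball d) :
    ‖⟪(y : EuclideanSpace ℂ (Fin d)), (x : EuclideanSpace ℂ (Fin d))⟫_ℂ‖ < 1 := by
  have hx : ‖(x : EuclideanSpace ℂ (Fin d))‖ < 1 := mem_ball_zero_iff.mp x.2
  have hy : ‖(y : EuclideanSpace ℂ (Fin d))‖ < 1 := mem_ball_zero_iff.mp y.2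
  calc _ ≤ ‖(y : EuclideanSpace ℂ (Fin d))‖ * ‖(x : EuclideanSpace ℂ (Fin d))‖ :=
        norm_inner_le_norm _ _
    _ < 1 := by nlinarith [norm_nonneg (x : EuclideanSpace ℂ (Fin d)),
        norm_nonneg (y : EuclideanSpace ℂ (Fin d))]

theorem conj_kernelFun {d : ℕ} (x y : Ball d) : conj (kernelFun d x y) = kernelFun d y x := by
  simp [kernelFun]

open scoped ComplexOrder in
theorem posSemidef_inner_pow {d : ℕ} (s : Finset (Ball d)) (n : ℕ) :
    (Matrix.of fun i j : s =>
      ⟪((i : Ball d) : EuclideanSpace ℂ (Fin d)),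
        ((j : Ball d) : EuclideanSpace ℂ (Fin d))⟫_ℂ ^ n).PosSemidef := by
  induction n with
  | zero =>
    have := Matrix.posSemidef_vecMulVec_self_star (fun _ : s => (1 : ℂ))
    convert this using 1
    ext i j
    simp [Matrix.vecMulVec]
  | succ n ih =>
    have h1 : (Matrix.gram ℂ fun i : s => ((i : Ball d) : EuclideanSpace ℂ (Fin d))).PosSemidef :=
      Matrix.posSemidef_gram ℂ _
    have h2 := ih.hadamard h1
    have he : (Matrix.of fun i j : s =>
        ⟪((i : Ball d) : EuclideanSpace ℂ (Fin d)),
          ((j : Ball d) : EuclideanSpace ℂ (Fin d))⟫_ℂ ^ (n + 1)) =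
        Matrix.hadamard (Matrix.of fun i j : s =>
          ⟪((i : Ball d) : EuclideanSpace ℂ (Fin d)),
            ((j : Ball d) : EuclideanSpace ℂ (Fin d))⟫_ℂ ^ n)
          (Matrix.gram ℂ fun i : s => ((i : Ball d) : EuclideanSpace ℂ (Fin d))) := by
      ext i j
      simp [pow_succ, Matrix.gram_apply]
    rw [he]
    exact h2

open scoped ComplexOrder in
theorem posSemidef_kernelMatrix (d : ℕ) : (kernelMatrix d).PosSemidef := by
  have key := (RKHS.posSemidef_tfae (K := kernelMatrix d)).out 0 2
  refine key.mpr ⟨?_, fun v => ?_⟩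
  · ext x y
    have h1 : star (ContinuousLinearMap.id ℂ ℂ) = ContinuousLinearMap.id ℂ ℂ :=
      star_one (ℂ →L[ℂ] ℂ)
    simp [kernelMatrix, Matrix.conjTranspose_apply, conj_kernelFun, h1]
  · have hs : ∀ x y : Ball d, HasSum (fun n : ℕ => conj (v x) * v y *
        ⟪(y : EuclideanSpace ℂ (Fin d)), (x : EuclideanSpace ℂ (Fin d))⟫_ℂ ^ n)
        ⟪kernelMatrix d y x (v x), v y⟫_ℂ := by
      intro x y
      have h1 := (hasSum_geometric_of_norm_lt_one (norm_inner_lt_one x y)).mul_left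
        (conj (v x) * v y)
      have h2 : ⟪kernelMatrix d y x (v x), v y⟫_ℂ = conj (v x) * v y *
          (1 - ⟪(y : EuclideanSpace ℂ (Fin d)), (x : EuclideanSpace ℂ (Fin d))⟫_ℂ)⁻¹ := by
        simp [kernelMatrix, kernelFun]
        ring
      rw [h2]
      exact h1
    have hsum : HasSum (fun n : ℕ => ∑ x ∈ v.support, ∑ y ∈ v.support, conj (v x) * v y *
        ⟪(y : EuclideanSpace ℂ (Fin d)), (x : EuclideanSpace ℂ (Fin d))⟫_ℂ ^ n)
        (v.sum fun x w => v.sum fun x' w' => ⟪kernelMatrix d x' x w, w'⟫_ℂ) :=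
      hasSum_sum fun x _ => hasSum_sum fun y _ => hs x y
    have hre := Complex.hasSum_re hsum
    refine hre.nonneg fun n => ?_
    have hp := (posSemidef_inner_pow v.support n).re_dotProduct_nonneg
      (fun i : v.support => conj (v i))
    refine hp.trans_eq ?_
    simp only [dotProduct, Matrix.mulVec, Matrix.of_apply, Pi.star_apply, RCLike.star_def,
      Complex.conj_conj, RCLike.re_to_complex]
    congr 1
    rw [Finset.sum_comm, ← Finset.sum_coe_sort v.support]
    refine Finset.sum_congr rfl fun x _ => ?_
    rw [← Finset.sum_coe_sort v.support, Finset.mul_sum]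
    refine Finset.sum_congr rfl fun y _ => ?_
    ring

instance (d : ℕ) : Fact (kernelMatrix d).PosSemidef := ⟨posSemidef_kernelMatrix d⟩

/-- The Drury-Arveson space `H²_d`: the reproducing kernel Hilbert space of functions on the
unit ball determined by the kernel `k`. -/
def Space (d : ℕ) : Type := RKHS.OfKernel (kernelMatrix d)

instance (d : ℕ) : NormedAddCommGroup (Space d) :=
  inferInstanceAs (NormedAddCommGroup (RKHS.OfKernel (kernelMatrix d)))

instance (d : ℕ) : InnerProductSpace ℂ (Space d) :=
  inferInstanceAs (InnerProductSpace ℂ (RKHS.OfKernel (kernelMatrix d)))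

instance (d : ℕ) : CompleteSpace (Space d) :=
  inferInstanceAs (CompleteSpace (RKHS.OfKernel (kernelMatrix d)))

instance (d : ℕ) : RKHS ℂ (Space d) (Ball d) ℂ :=
  inferInstanceAs (RKHS ℂ (RKHS.OfKernel (kernelMatrix d)) (Ball d) ℂ)

theorem kernel_space (d : ℕ) : RKHS.kernel (Space d) = kernelMatrix d :=
  RKHS.OfKernel.kernel_ofKernel

/-- The kernel function `k_x ∈ H²_d`. -/
def kernelAt {d : ℕ} (x : Ball d) : Space d := RKHS.kerFun (Space d) x 1

theorem kernelAt_apply {d : ℕ} (x y : Ball d) : kernelAt x y = kernelFun d y x := by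
  rw [kernelAt, RKHS.kerFun_apply, kernel_space]
  simp [kernelMatrix]

theorem inner_kernelAt {d : ℕ} (x : Ball d) (f : Space d) : ⟪kernelAt x, f⟫_ℂ = f x := by
  simp [kernelAt]

/-! ### Varieties and their Hilbert spaces -/

/-- A subvariety of the ball: the common zero set of a non-empty family in `H²_d`. -/
def IsVariety {d : ℕ} (V : Set (Ball d)) : Prop :=
  ∃ F : Set (Space d), F.Nonempty ∧ V = {x | ∀ f ∈ F, f x = 0}

/-- `H_V`, the closed linear span of the kernel functions at the points of `V`. -/
def HSub {d : ℕ} (V : Set (Ball d)) : Submodule ℂ (Space d) :=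
  (Submodule.span ℂ (kernelAt '' V)).topologicalClosure

instance {d : ℕ} (V : Set (Ball d)) : CompleteSpace (HSub V) :=
  (Submodule.isClosed_topologicalClosure _).completeSpace_coe

/-- `H_V` as a reproducing kernel Hilbert space on `V`: an element is identified with its
restriction to `V`. -/
instance instRKHSHSub {d : ℕ} (V : Set (Ball d)) : RKHS ℂ (HSub V) V ℂ where
  coeCLM := .pi fun x : V =>
    (ContinuousLinearMap.proj (x : Ball d) ∘L RKHS.coeCLM ℂ) ∘L (HSub V).subtypeL
  coeCLM_injective := by
    refine (injective_iff_map_eq_zero _).mpr fun f hf => ?_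
    have h0 : ∀ x ∈ V, (f : Space d) x = 0 := fun x hx => congrFun hf ⟨x, hx⟩
    have hle : Submodule.span ℂ (kernelAt '' V) ≤ (ℂ ∙ (f : Space d))ᗮ := by
      rw [Submodule.span_le]
      rintro _ ⟨x, hx, rfl⟩
      rw [SetLike.mem_coe, Submodule.mem_orthogonal_singleton_iff_inner_left, inner_kernelAt,
        h0 x hx]
    have hmem : (f : Space d) ∈ (ℂ ∙ (f : Space d))ᗮ :=
      Submodule.topologicalClosure_minimal _ hle (Submodule.isClosed_orthogonal _) f.2
    rw [Submodule.mem_orthogonal_singleton_iff_inner_left, inner_self_eq_zero] at hmem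
    exact Subtype.ext hmem

theorem HSub_apply {d : ℕ} (V : Set (Ball d)) (f : HSub V) (x : V) :
    f x = (f : Space d) (x : Ball d) := rfl

/-! ### Multipliers of a reproducing kernel Hilbert space -/

section Multiplier

variable {X : Type*} (H : Type*) [NormedAddCommGroup H] [InnerProductSpace ℂ H] [RKHS ℂ H X ℂ]

/-- The multiplier algebra `Mult(H)`: all functions `f` with `f · H ⊆ H`. -/
def Mult : Subalgebra ℂ (X → ℂ) where
  carrier := {f | ∀ g : H, ∃ h : H, ⇑h = f * ⇑g}
  mul_mem' := by
    intro a b ha hb g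
    obtain ⟨h, hh⟩ := hb g
    obtain ⟨h', hh'⟩ := ha h
    exact ⟨h', by rw [hh', hh, mul_assoc]⟩
  add_mem' := by
    intro a b ha hb g
    obtain ⟨h, hh⟩ := ha g
    obtain ⟨h', hh'⟩ := hb g
    exact ⟨h + h', by rw [RKHS.coe_add, hh, hh', add_mul]⟩
  algebraMap_mem' := by
    intro c g
    exact ⟨c • g, by ext x; simp [Algebra.algebraMap_eq_smul_one]⟩

variable {H}

/-- The product `f g ∈ H` of a multiplier `f` and an element `g` of `H`. -/
def mulElem (f : Mult H) (g : H) : H := (f.2 g).choose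

theorem mulElem_apply (f : Mult H) (g : H) (x : X) :
    mulElem f g x = (f : X → ℂ) x * g x :=
  congrFun (f.2 g).choose_spec x

variable [CompleteSpace H]

/-- The multiplication operator `M_f : g ↦ f g`, bounded by the closed graph theorem. -/
def mulOp (f : Mult H) : H →L[ℂ] H :=
  ContinuousLinearMap.ofSeqClosedGraph
    (g := { toFun := mulElem f
            map_add' := fun a b => by
              refine RKHS.ext fun x => ?_
              simp [mulElem_apply, mul_add]
            map_smul' := fun c a => by
              refine RKHS.ext fun x => ?_
              simp [mulElem_apply, mul_left_comm] })
    (by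
      intro u a b hu hb
      refine RKHS.ext fun x => ?_
      have h1 := ((RKHS.continuous_eval (H := H) x).tendsto b).comp hb
      have h2 := ((RKHS.continuous_eval (H := H) x).tendsto a).comp hu
      refine tendsto_nhds_unique h1 ?_
      simpa [Function.comp_def, mulElem_apply] using h2.const_mul ((f : X → ℂ) x))

theorem mulOp_apply (f : Mult H) (g : H) (x : X) :
    mulOp f g x = (f : X → ℂ) x * g x :=
  mulElem_apply f g x

/-- The row operator `(M_{f₁}, …, M_{f_d}) : ⊕ H → H`, `(g₁, …, g_d) ↦ ∑ fᵢ gᵢ`, on the Hilbert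
space direct sum. -/
def rowOp {ι : Type*} [Fintype ι] (f : ι → Mult H) : PiLp 2 (fun _ : ι => H) →L[ℂ] H :=
  ∑ i, mulOp (f i) ∘L PiLp.proj 2 (fun _ : ι => H) i

/-- The operator `(M_{a_{ij}})` on the Hilbert space direct sum `⊕ H` given by a matrix over the
multiplier algebra. -/
def matOp {ι : Type*} [Fintype ι] (A : Matrix ι ι (Mult H)) :
    PiLp 2 (fun _ : ι => H) →L[ℂ] PiLp 2 (fun _ : ι => H) :=
  (PiLp.continuousLinearEquiv 2 ℂ (fun _ : ι => H)).symm.toContinuousLinearMap ∘L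
    ContinuousLinearMap.pi fun i => rowOp (A i)

theorem matOp_apply {ι : Type*} [Fintype ι] (A : Matrix ι ι (Mult H))
    (g : PiLp 2 (fun _ : ι => H)) (i : ι) : matOp A g i = ∑ j, mulOp (A i j) (g j) := by
  simp [matOp, rowOp]

variable (H) in
/-- A vector valued multiplier: a map to `ℂ^d` whose components are multipliers. -/
def IsVectorMultiplier {d : ℕ} (F : X → EuclideanSpace ℂ (Fin d)) : Prop :=
  ∀ i, (fun x => F x i) ∈ Mult H

/-- The multiplier norm of a vector valued multiplier: the norm of its row operator. -/
def vectorMultNorm {d : ℕ} {F : X → EuclideanSpace ℂ (Fin d)} (hF : IsVectorMultiplier H F) : ℝ :=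
  ‖rowOp fun i => (⟨fun x => F x i, hF i⟩ : Mult H)‖

end Multiplier

/-! ### Completely bounded maps -/

section CompletelyBounded

variable {X Y : Type*} {H K : Type*}
  [NormedAddCommGroup H] [InnerProductSpace ℂ H] [RKHS ℂ H X ℂ] [CompleteSpace H]
  [NormedAddCommGroup K] [InnerProductSpace ℂ K] [RKHS ℂ K Y ℂ] [CompleteSpace K]

/-- The operator norm, in `[0, ∞]`, of the amplification
`φ⁽ⁿ⁾ : M_n(Mult H) → M_n(Mult K)`, `[f_{ij}] ↦ [φ(f_{ij})]`. -/
def ampNorm (φ : Mult H →ₗ[ℂ] Mult K) (n : ℕ) : ℝ≥0∞ :=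
  ⨆ (A : Matrix (Fin n) (Fin n) (Mult H)) (_ : ‖matOp A‖ ≤ 1), ‖matOp (A.map φ)‖ₑ

/-- The completely bounded norm `‖φ‖_cb = supₙ ‖φ⁽ⁿ⁾‖`, in `[0, ∞]`. -/
def cbNorm (φ : Mult H →ₗ[ℂ] Mult K) : ℝ≥0∞ := ⨆ n : ℕ, ampNorm φ n

end CompletelyBounded

/-! ### Isomorphisms -/

/-- The multiplier algebra `M_V = Mult(H_V)`. -/
abbrev MAlg {d : ℕ} (V : Set (Ball d)) : Subalgebra ℂ (V → ℂ) := Mult (HSub V)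

/-- The map `G : W → V`, followed by the inclusion of `V` into `ℂ^d`. -/
def toVector {d : ℕ} {V W : Set (Ball d)} (G : W → V) : W → EuclideanSpace ℂ (Fin d) :=
  fun y => ((G y : Ball d) : EuclideanSpace ℂ (Fin d))

/-- `G` is a multiplier biholomorphism of `W` onto `V`: a vector valued multiplier on `W` with an
inverse `V → W` that is a vector valued multiplier on `V`. -/
structure IsMultBiholomorphism {d : ℕ} {V W : Set (Ball d)} (G : W → V) : Prop where
  isVectorMultiplier : IsVectorMultiplier (HSub W) (toVector G)
  exists_inverse : ∃ F : V → W, IsVectorMultiplier (HSub V) (toVector F) ∧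
    F ∘ G = id ∧ G ∘ F = id

/-- A multiplier algebra isomorphism: an algebra isomorphism which is completely bounded, has a
completely bounded inverse, and is the composition with some bijection `W → V`. -/
structure IsMultAlgIso {d : ℕ} {V W : Set (Ball d)} (φ : MAlg V ≃ₐ[ℂ] MAlg W) : Prop where
  cb : cbNorm φ.toLinearMap < ∞
  cb_symm : cbNorm φ.symm.toLinearMap < ∞
  exists_bijection : ∃ G : W → V, Function.Bijective G ∧
    ∀ f : MAlg V, (φ f : W → ℂ) = (f : V → ℂ) ∘ G

end DruryArveson

end

/-!
The coordinate row `Z = (z₁, …, z_d)` on a subset `V` of the ball with at least two points has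
multiplier norm exactly `1` (`norm_rowOp_coord`). If `T` is its row operator on `H_V` and `E`
denotes the evaluation `h ↦ h(0)`, then `⟨x, y⟩ k(x, y) + 1 = k(x, y)` says that
`T T* + E* E = 1`, that is, `‖T* h‖² + |h(0)|² = ‖h‖²`. Hence `T*` is a contraction, and it is
isometric on the non-zero vector `k_a - k_b` for distinct `a, b ∈ V`, which vanishes at `0`.

Since `φ` is composition with `G`, it maps the row `Z` on `V` to the row `G` on `W`, and `φ⁻¹`
maps `G` to `Z`. A row over a multiplier algebra, padded with zeros to a square matrix, keeps its
norm, so a completely bounded map increases the norm of a row by at most the factor `‖·‖_cb`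
(`enorm_rowOp_map_le`). Applied to `φ` this gives `‖G‖ ≤ ‖φ‖_cb ‖Z‖ = ‖φ‖_cb`, and applied to
`φ⁻¹` it gives `1 = ‖Z‖ ≤ ‖φ⁻¹‖_cb ‖G‖`.
-/

noncomputable section

open scoped ENNReal InnerProductSpace ComplexConjugate

namespace DruryArveson

section Rows

variable {X Y : Type*} {H K : Type*}
  [NormedAddCommGroup H] [InnerProductSpace ℂ H] [RKHS ℂ H X ℂ] [CompleteSpace H]
  [NormedAddCommGroup K] [InnerProductSpace ℂ K] [RKHS ℂ K Y ℂ] [CompleteSpace K]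

theorem rowOp_apply {ι : Type*} [Fintype ι] (f : ι → Mult H) (g : PiLp 2 (fun _ : ι => H)) :
    rowOp f g = ∑ i, mulOp (f i) (g i) := by
  simp [rowOp]

theorem rowOp_apply_apply {ι : Type*} [Fintype ι] (f : ι → Mult H)
    (g : PiLp 2 (fun _ : ι => H)) (x : X) :
    rowOp f g x = ∑ i, (f i : X → ℂ) x * g i x := by
  have h := map_sum ((ContinuousLinearMap.proj x : (X → ℂ) →L[ℂ] ℂ) ∘L RKHS.coeCLM (H := H) ℂ)
    (fun i => mulOp (f i) (g i)) Finset.univ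
  rw [rowOp_apply]
  refine h.trans (Finset.sum_congr rfl fun i _ => mulOp_apply (f i) (g i) x)

theorem norm_rowOp_smul_le {ι : Type*} [Fintype ι] (c : ℂ) (f : ι → Mult H) :
    ‖rowOp fun i => c • f i‖ ≤ ‖c‖ * ‖rowOp f‖ := by
  refine ContinuousLinearMap.opNorm_le_bound _
    (mul_nonneg (norm_nonneg c) (rowOp f).opNorm_nonneg) fun g => ?_
  have h : rowOp (fun i => c • f i) g = c • rowOp f g := by
    refine RKHS.ext fun x => ?_
    simp [rowOp_apply_apply (X := X), Finset.mul_sum, mul_assoc]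
  rw [h, norm_smul, mul_assoc]
  exact mul_le_mul_of_nonneg_left ((rowOp f).le_opNorm g) (norm_nonneg c)

/-- The square matrix with the row `f` in position `i₀` and zeros elsewhere. -/
def rowMatrix {ι : Type*} [DecidableEq ι] (i₀ : ι) (f : ι → Mult H) : Matrix ι ι (Mult H) :=
  Matrix.of fun i j => if i = i₀ then f j else 0

theorem norm_matOp_rowMatrix {ι : Type*} [Fintype ι] [DecidableEq ι] (i₀ : ι) (f : ι → Mult H) :
    ‖matOp (rowMatrix i₀ f)‖ = ‖rowOp f‖ := by
  have hg : ∀ g, ‖matOp (rowMatrix i₀ f) g‖ = ‖rowOp f g‖ := by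
    intro g
    have hzero : mulOp (0 : Mult H) = 0 := by
      refine ContinuousLinearMap.ext fun u => RKHS.ext fun x => ?_
      simp [mulOp_apply (X := X)]
    have h : ∀ i, matOp (rowMatrix i₀ f) g i = if i = i₀ then rowOp f g else 0 := by
      intro i
      rw [matOp_apply, rowOp_apply]
      split_ifs with hi <;> simp [rowMatrix, hi, hzero]
    rw [PiLp.norm_eq_of_L2]
    simp only [h, apply_ite norm, norm_zero, ite_pow]
    simp
  refine le_antisymm ?_ ?_
  · exact ContinuousLinearMap.opNorm_le_bound _ (rowOp f).opNorm_nonneg fun g =>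
      (hg g).trans_le ((rowOp f).le_opNorm g)
  · exact ContinuousLinearMap.opNorm_le_bound _ (matOp (rowMatrix i₀ f)).opNorm_nonneg fun g =>
      (hg g).symm.trans_le ((matOp (rowMatrix i₀ f)).le_opNorm g)

/-- A linear map of multiplier algebras increases the norm of a row by at most its completely
bounded norm. The strictly positive bound `r` makes the rescaling to norm at most one possible
also for a row of norm zero. -/
theorem enorm_rowOp_map_le (φ : Mult H →ₗ[ℂ] Mult K) {n : ℕ} (f : Fin n → Mult H) {r : ℝ}
    (hr : 0 < r) (hf : ‖rowOp f‖ ≤ r) :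
    ‖rowOp fun i => φ (f i)‖ₑ ≤ ENNReal.ofReal r * cbNorm φ := by
  rcases n with _ | n
  · have h : rowOp (fun i => φ (f i)) = 0 := by simp [rowOp]
    rw [h, ← ofReal_norm (0 : PiLp 2 (fun _ : Fin 0 => K) →L[ℂ] K),
      ContinuousLinearMap.opNorm_zero, ENNReal.ofReal_zero]
    exact zero_le
  have hr0 : (r : ℂ) ≠ 0 := by exact_mod_cast hr.ne'
  set u : Fin (n + 1) → Mult H := fun i => (r : ℂ)⁻¹ • f i with hu
  have hA : ‖matOp (rowMatrix 0 u)‖ ≤ 1 := by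
    rw [norm_matOp_rowMatrix]
    refine (norm_rowOp_smul_le _ f).trans ?_
    rw [norm_inv, Complex.norm_real, Real.norm_of_nonneg hr.le, inv_mul_le_iff₀ hr, mul_one]
    exact hf
  have hmap : (rowMatrix 0 u).map φ = rowMatrix 0 fun i => φ (u i) := by
    ext i j : 2
    by_cases hi : i = 0 <;> simp [rowMatrix, hi]
  have h1 : ‖rowOp fun i => φ (u i)‖ₑ ≤ cbNorm φ := by
    have h2 : ‖matOp ((rowMatrix 0 u).map φ)‖ₑ ≤ cbNorm φ :=
      le_trans (le_iSup₂ (f := fun (A : Matrix (Fin (n + 1)) (Fin (n + 1)) (Mult H))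
        (_ : ‖matOp A‖ ≤ 1) => ‖matOp (A.map φ)‖ₑ) _ hA) (le_iSup (ampNorm φ) (n + 1))
    rwa [hmap, ← ofReal_norm (matOp (rowMatrix 0 fun i => φ (u i))), norm_matOp_rowMatrix,
      ofReal_norm (rowOp fun i => φ (u i))] at h2
  have h3 : (fun i => φ (f i)) = fun i => (r : ℂ) • φ (u i) := by
    funext i
    rw [hu, ← map_smul, smul_inv_smul₀ hr0]
  have h4 := norm_rowOp_smul_le (r : ℂ) fun i => φ (u i)
  rw [Complex.norm_real, Real.norm_of_nonneg hr.le] at h4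
  rw [h3, ← ofReal_norm (rowOp fun i => (r : ℂ) • φ (u i))]
  refine (ENNReal.ofReal_le_ofReal h4).trans ?_
  rw [ENNReal.ofReal_mul hr.le, ofReal_norm (rowOp fun i => φ (u i))]
  exact mul_le_mul_right h1 _

end Rows

section Coordinates

variable {d : ℕ} {V : Set (Ball d)}

/-- The kernel function at a point of `V`, as an element of `H_V`. -/
def kernelIn (x : V) : HSub V :=
  ⟨kernelAt (x : Ball d),
    Submodule.le_topologicalClosure _ (Submodule.subset_span ⟨x, x.2, rfl⟩)⟩

theorem inner_kernelIn (x : V) (g : HSub V) : ⟪kernelIn x, g⟫_ℂ = g x :=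
  inner_kernelAt (x : Ball d) (g : Space d)

theorem kernelIn_apply (x y : V) : kernelIn x y = kernelFun d y x :=
  kernelAt_apply (x : Ball d) (y : Ball d)

theorem kernelIn_injective : Function.Injective (kernelIn (V := V)) := by
  intro a b hab
  have key : ∀ y : V, ⟪(a : Ball d).1, (y : Ball d).1⟫_ℂ = ⟪(b : Ball d).1, (y : Ball d).1⟫_ℂ := by
    intro y
    have h : kernelIn a y = kernelIn b y := by rw [hab]
    rw [kernelIn_apply, kernelIn_apply, kernelFun, kernelFun, one_div, one_div, inv_inj] at h
    exact sub_right_injective h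
  have h0 : ⟪(a : Ball d).1 - (b : Ball d).1, (a : Ball d).1 - (b : Ball d).1⟫_ℂ = 0 := by
    rw [inner_sub_right, inner_sub_left, inner_sub_left, key a, key b]
    simp
  exact Subtype.ext (Subtype.ext (sub_eq_zero.mp (inner_self_eq_zero.mp h0)))

/-- The origin of the ball. -/
def origin (d : ℕ) : Ball d := ⟨0, by simp⟩

/-- Evaluation at the origin, as a functional on `H_V`; the origin need not lie in `V`. -/
def evalOrigin (V : Set (Ball d)) : HSub V →L[ℂ] ℂ :=
  innerSL ℂ (kernelAt (origin d)) ∘L (HSub V).subtypeL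

theorem evalOrigin_kernelIn (x : V) : evalOrigin V (kernelIn x) = 1 := by
  have h : evalOrigin V (kernelIn x) = kernelAt (x : Ball d) (origin d) :=
    inner_kernelAt (origin d) (kernelAt (x : Ball d))
  rw [h, kernelAt_apply, kernelFun]
  simp [origin]

theorem adjoint_rowOp_kernelIn {ι : Type*} [Fintype ι] (f : ι → MAlg V) (x : V) :
    (rowOp f).adjoint (kernelIn x) =
      WithLp.toLp 2 fun i => conj ((f i : V → ℂ) x) • kernelIn x := by
  refine ext_inner_right ℂ fun g => ?_
  rw [ContinuousLinearMap.adjoint_inner_left, inner_kernelIn, rowOp_apply_apply,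
    PiLp.inner_apply]
  refine Finset.sum_congr rfl fun i _ => ?_
  rw [inner_smul_left, inner_kernelIn, Complex.conj_conj]

/-- The identity `T T* + E* E = 1`, in weak form, for the row operator `T` of the coordinate
functions and the evaluation `E` at the origin. -/
theorem inner_adjoint_rowOp_coord (Z : Fin d → MAlg V)
    (hZ : ∀ i x, (Z i : V → ℂ) x = (x : Ball d).1 i) (h h' : HSub V) :
    ⟪(rowOp Z).adjoint h, (rowOp Z).adjoint h'⟫_ℂ + ⟪evalOrigin V h, evalOrigin V h'⟫_ℂ =
      ⟪h, h'⟫_ℂ := by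
  set S : HSub V →L[ℂ] HSub V :=
    rowOp Z ∘L (rowOp Z).adjoint + (evalOrigin V).adjoint ∘L evalOrigin V with hS
  have hinner : ∀ u v : HSub V, ⟪u, S v⟫_ℂ =
      ⟪(rowOp Z).adjoint u, (rowOp Z).adjoint v⟫_ℂ + ⟪evalOrigin V u, evalOrigin V v⟫_ℂ := by
    intro u v
    rw [ContinuousLinearMap.adjoint_inner_left, ← ContinuousLinearMap.adjoint_inner_right,
      ← inner_add_right]
    rfl
  have hsymm : ∀ u v : HSub V, ⟪S u, v⟫_ℂ = ⟪u, S v⟫_ℂ := by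
    intro u v
    rw [← inner_conj_symm, hinner, hinner, map_add, inner_conj_symm, inner_conj_symm]
  have hker : ∀ x : V, S (kernelIn x) = kernelIn x := by
    intro x
    refine RKHS.ext fun y => ?_
    rw [← inner_kernelIn, hinner, adjoint_rowOp_kernelIn, adjoint_rowOp_kernelIn,
      evalOrigin_kernelIn, evalOrigin_kernelIn, kernelIn_apply, PiLp.inner_apply]
    have hne : 1 - ⟪(x : Ball d).1, (y : Ball d).1⟫_ℂ ≠ 0 := by
      intro h0
      have h1 := norm_inner_lt_one (y : Ball d) (x : Ball d)
      rw [← sub_eq_zero.mp h0] at h1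
      simp at h1
    have hsum : ∑ i, (y : Ball d).1 i * conj ((x : Ball d).1 i) =
        ⟪(x : Ball d).1, (y : Ball d).1⟫_ℂ := by
      simp [PiLp.inner_apply]
    have hterm : ∀ i, ⟪conj ((Z i : V → ℂ) y) • kernelIn y, conj ((Z i : V → ℂ) x) • kernelIn x⟫_ℂ
        = ((y : Ball d).1 i * conj ((x : Ball d).1 i)) * kernelFun d y x := by
      intro i
      rw [inner_smul_left, inner_smul_right, inner_kernelIn, kernelIn_apply, hZ, hZ,
        Complex.conj_conj, mul_assoc]
    simp only [hterm]
    rw [← Finset.sum_mul, hsum, kernelFun, inner_self_eq_norm_sq_to_K]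
    field_simp
    simp
  have hid : S h' = h' := by
    refine RKHS.ext fun x => ?_
    rw [← inner_kernelIn, ← hsymm, hker, inner_kernelIn]
  rw [← hinner, hid]

theorem norm_sq_adjoint_rowOp_coord (Z : Fin d → MAlg V)
    (hZ : ∀ i x, (Z i : V → ℂ) x = (x : Ball d).1 i) (h : HSub V) :
    ‖(rowOp Z).adjoint h‖ ^ 2 + ‖evalOrigin V h‖ ^ 2 = ‖h‖ ^ 2 := by
  have := inner_adjoint_rowOp_coord Z hZ h h
  simp only [inner_self_eq_norm_sq_to_K] at this
  exact_mod_cast this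

/-- The coordinate row has norm one as soon as `V` has two points; on a single point `a` its norm
would be `‖a‖ < 1`. -/
theorem norm_rowOp_coord (hV : V.Nontrivial) (Z : Fin d → MAlg V)
    (hZ : ∀ i x, (Z i : V → ℂ) x = (x : Ball d).1 i) : ‖rowOp Z‖ = 1 := by
  rw [← LinearIsometryEquiv.norm_map ContinuousLinearMap.adjoint (rowOp Z)]
  refine le_antisymm ?_ ?_
  · refine ContinuousLinearMap.opNorm_le_bound _ zero_le_one fun h => ?_
    rw [one_mul]
    refine le_of_sq_le_sq ?_ (norm_nonneg _)
    rw [← norm_sq_adjoint_rowOp_coord Z hZ h]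
    exact le_add_of_nonneg_right (sq_nonneg _)
  · obtain ⟨a, ha, b, hb, hab⟩ := hV
    set h : HSub V := kernelIn ⟨a, ha⟩ - kernelIn ⟨b, hb⟩ with hh
    have hpos : 0 < ‖h‖ := norm_pos_iff.mpr <| sub_ne_zero.mpr fun he =>
      hab (congrArg Subtype.val (kernelIn_injective he))
    have hev : evalOrigin V h = 0 := by
      rw [hh, map_sub, evalOrigin_kernelIn, evalOrigin_kernelIn, sub_self]
    have hsq := norm_sq_adjoint_rowOp_coord Z hZ h
    rw [hev, norm_zero, zero_pow two_ne_zero, add_zero] at hsq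
    have heq : ‖(rowOp Z).adjoint h‖ = ‖h‖ :=
      (sq_eq_sq₀ (norm_nonneg _) (norm_nonneg _)).mp hsq
    have hle := (rowOp Z).adjoint.le_opNorm h
    rw [heq] at hle
    exact one_le_of_le_mul_right₀ hpos hle

end Coordinates

end DruryArveson

end

theorem theorem4p0p2 (d : ℕ) (V W : Set (DruryArveson.Ball d))
    (hV : DruryArveson.IsVariety V) (hW : DruryArveson.IsVariety W) (hV2 : V.Nontrivial)
    (φ : DruryArveson.MAlg V ≃ₐ[ℂ] DruryArveson.MAlg W) (hφ : DruryArveson.IsMultAlgIso φ)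
    (G : W → V) (hG : DruryArveson.IsMultBiholomorphism G)
    (hφG : ∀ f : DruryArveson.MAlg V, (φ f : W → ℂ) = (f : V → ℂ) ∘ G) :
    1 / DruryArveson.cbNorm φ.symm.toLinearMap ≤
        ENNReal.ofReal (DruryArveson.vectorMultNorm hG.isVectorMultiplier) ∧
      ENNReal.ofReal (DruryArveson.vectorMultNorm hG.isVectorMultiplier) ≤
        DruryArveson.cbNorm φ.toLinearMap := by
  obtain ⟨F, -, -, hGF⟩ := hG.exists_inverse
  set g : Fin d → DruryArveson.MAlg W := fun i =>
    ⟨fun x => DruryArveson.toVector G x i, hG.isVectorMultiplier i⟩ with hg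
  -- The coordinate functions are multipliers on `V` because `φ` is onto: they are `φ⁻¹` of `G`.
  set Z : Fin d → DruryArveson.MAlg V := fun i => φ.symm (g i)
  have hφZ : (fun i => φ.toLinearMap (Z i)) = g := by
    funext i
    exact φ.apply_symm_apply (g i)
  have hZ : ∀ i x, (Z i : V → ℂ) x = (x : DruryArveson.Ball d).1 i := by
    intro i x
    have h1 : (φ (Z i) : W → ℂ) (F x) = (Z i : V → ℂ) (G (F x)) := congrFun (hφG (Z i)) (F x)
    have h2 : G (F x) = x := congrFun hGF x
    have h3 : φ (Z i) = g i := φ.apply_symm_apply (g i)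
    rw [h3, h2] at h1
    rw [← h1]
    simp [hg, DruryArveson.toVector, h2]
  have hnorm : ‖DruryArveson.rowOp Z‖ = 1 := DruryArveson.norm_rowOp_coord hV2 Z hZ
  change 1 / _ ≤ ENNReal.ofReal ‖DruryArveson.rowOp g‖ ∧ ENNReal.ofReal ‖DruryArveson.rowOp g‖ ≤ _
  constructor
  -- The row bound needs a strictly positive radius, so `‖G‖` is approached by `s > ‖G‖`.
  · refine le_of_forall_gt_imp_ge_of_dense fun s hs => ?_
    induction s with
    | top => exact le_top
    | coe s =>
      have hs' : ‖DruryArveson.rowOp g‖ < s := by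
        rwa [← ENNReal.ofReal_coe_nnreal, ENNReal.ofReal_lt_ofReal_iff_of_nonneg
          (DruryArveson.rowOp g).opNorm_nonneg] at hs
      have h := DruryArveson.enorm_rowOp_map_le φ.symm.toLinearMap g
        ((DruryArveson.rowOp g).opNorm_nonneg.trans_lt hs') hs'.le
      have hZe : ‖DruryArveson.rowOp Z‖ₑ = 1 := by
        rw [← ofReal_norm (DruryArveson.rowOp Z), hnorm, ENNReal.ofReal_one]
      rw [ENNReal.ofReal_coe_nnreal] at h
      exact ENNReal.div_le_of_le_mul (hZe.symm.trans_le h)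
  · have h := DruryArveson.enorm_rowOp_map_le φ.toLinearMap Z one_pos hnorm.le
    rwa [hφZ, ENNReal.ofReal_one, one_mul, ← ofReal_norm (DruryArveson.rowOp g)] at h
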